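/- For a finite set $X\subset\mathbb{R}^n$, let $\mathcal{R}(X)$ be its Vietoris–Rips complex at scale $1$: the abstract simplicial complex with vertex set $X$ whose simplices are the nonempty subsets of $X$ of diameter at most $1$. Let $p\colon|\mathcal{R}(X)|\to\mathbb{R}^n$ be the map on the geometric realization that sends each vertex to itself and is affine on every simplex, and let the shadow $\mathcal{S}(X)=p(|\mathcal{R}(X)|)$ be its image; $p$ is regarded as a map $|\mathcal{R}(X)|\to\mathcal{S}(X)$. A continuous map is called $k$-connected if it induces isomorphisms on $\pi_i$ for all $0\le i\le k$ (and all base points). Proposition. There exists a finite set of points $X\subset\mathbb{R}^2$ for which $p\colon|\mathcal{R}(X)|\to\mathcal{S}(X)$ is not $2$-connected. More precisely, let $1/2<r\le 1/\sqrt{3}$ and let $X_r=\{(r\cos\frac{k\pi}{3},\,r\sin\frac{k\pi}{3}) : 0\le k\le 5\}$ be the vertex set of a regular hexagon of radius $r$ centered at the origin. Then: 1. two distinct points $x,y\in X_r$ fail to be joined by an edge of $\mathcal{R}(X_r)$ if and only if $y=-x$, i.e. only the three main diagonals are missing; 2. $\mathcal{R}(X_r)$ is isomorphic, as a simplicial complex,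 to the boundary complex of the octahedron; 3. $|\mathcal{R}(X_r)|$ is homotopy equivalent to the sphere $S^2$; 4. the shadow $\mathcal{S}(X_r)$ is the full hexagon (including its interior), i.e. the convex hull of $X_r$, and is contractible; 5. the projection $p\colon|\mathcal{R}(X_r)|\to\mathcal{S}(X_r)$ is not $2$-connected. -/

import Mathlib

namespace RipsShadow

/-! ### Abstract simplicial complexes and their geometric realizations -/

/-- Two distinct vertices are joined by an edge of `K`. -/
def Adjacent {V : Type*} (K : AbstractSimplicialComplex V) (x y : V) : Prop :=
  x ≠ y ∧ ∃ s ∈ K.faces, x ∈ s ∧ y ∈ s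

/-- `K` and `L` are isomorphic simplicial complexes: there is a bijection of the vertices under
which the simplices of `K` correspond exactly to the simplices of `L`. -/
def SimpliciallyIsomorphic {V W : Type*} (K : AbstractSimplicialComplex V)
    (L : AbstractSimplicialComplex W) : Prop :=
  ∃ e : V ≃ W, ∀ s : Finset V, s ∈ K.faces ↔ s.map e.toEmbedding ∈ L.faces

/-- The geometric realization of a finite simplicial complex: the points of the standard simplex
(in barycentric coordinates) whose support is contained in some simplex of the complex, with the
subspace topology. -/
def realization {V : Type*} [Fintype V] (K : AbstractSimplicialComplex V) : Set (V → ℝ) :=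
  {w | w ∈ stdSimplex ℝ V ∧ ∃ s ∈ K.faces, ∀ v, v ∉ s → w v = 0}

/-- The boundary complex of the octahedron. The six vertices `± e i` of the octahedron are written
`(i, true)` and `(i, false)`; a nonempty set of vertices spans a simplex if and only if it contains
no antipodal pair. -/
def octahedron : AbstractSimplicialComplex (Fin 3 × Bool) where
  faces := {s | s.Nonempty ∧ ∀ i : Fin 3, ¬ ((i, true) ∈ s ∧ (i, false) ∈ s)}
  isRelLowerSet_faces := by
    intro s hs
    exact ⟨hs.1, fun t hts ht => ⟨ht, fun i hi => hs.2 i ⟨hts hi.1, hts hi.2⟩⟩⟩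
  singleton_mem := by
    intro v
    refine ⟨Finset.singleton_nonempty v, fun i hi => ?_⟩
    have h := (Finset.mem_singleton.1 hi.1).trans (Finset.mem_singleton.1 hi.2).symm
    simp at h

/-! ### Rips complexes, the projection and the shadow -/

/-- The Vietoris–Rips complex (at scale `1`) of a finite set `X` of points in `ℝⁿ`: its vertices
are the points of `X`, and its simplices are the nonempty subsets of `X` of diameter at most `1`. -/
def ripsComplex {n : ℕ} (X : Finset (EuclideanSpace ℝ (Fin n))) : AbstractSimplicialComplex X where
  faces := {s | s.Nonempty ∧
    ∀ x ∈ s, ∀ y ∈ s, dist (x : EuclideanSpace ℝ (Fin n)) (y : EuclideanSpace ℝ (Fin n)) ≤ 1}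
  isRelLowerSet_faces := by
    intro s hs
    exact ⟨hs.1, fun t hts ht => ⟨ht, fun x hx y hy => hs.2 x (hts hx) y (hts hy)⟩⟩
  singleton_mem := by
    intro v
    refine ⟨Finset.singleton_nonempty v, fun x hx y hy => ?_⟩
    rw [Finset.mem_singleton.1 hx, Finset.mem_singleton.1 hy, dist_self]
    exact zero_le_one

/-- The canonical map from the realization of a complex with vertices in `ℝⁿ` to `ℝⁿ`, which is
affine on each simplex and sends each vertex to itself. -/
noncomputable def affineMap {n : ℕ} {X : Finset (EuclideanSpace ℝ (Fin n))}
    (K : AbstractSimplicialComplex X) : C(realization K, EuclideanSpace ℝ (Fin n)) where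
  toFun w := ∑ v : X, w.1 v • (v : EuclideanSpace ℝ (Fin n))
  continuous_toFun := continuous_finsetSum _ fun v _ =>
    ((continuous_apply v).comp continuous_subtype_val).smul continuous_const

/-- The shadow: the image of the canonical map to `ℝⁿ`. -/
def shadow {n : ℕ} {X : Finset (EuclideanSpace ℝ (Fin n))}
    (K : AbstractSimplicialComplex X) : Set (EuclideanSpace ℝ (Fin n)) :=
  Set.range (affineMap K)

/-- The projection from the realization of a complex onto its shadow. -/
noncomputable def projection {n : ℕ} {X : Finset (EuclideanSpace ℝ (Fin n))}
    (K : AbstractSimplicialComplex X) : C(realization K, shadow K) where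
  toFun w := ⟨affineMap K w, Set.mem_range_self w⟩
  continuous_toFun := by fun_prop

/-! ### Induced maps on homotopy groups and `k`-connected maps -/

section Homotopy

variable {X Y : Type*} [TopologicalSpace X] [TopologicalSpace Y]

/-- The map induced on path components. -/
def pi0Map (f : C(X, Y)) : ZerothHomotopy X → ZerothHomotopy Y :=
  Quotient.map' f fun _ _ h => h.map f.continuous

/-- Composition of a generalized loop with a continuous map. -/
def genLoopMap {N : Type*} (f : C(X, Y)) (x : X) (p : GenLoop N X x) : GenLoop N Y (f x) :=
  ⟨f.comp p.1, fun y hy => congrArg f (p.2 y hy)⟩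

/-- The map induced on `π_ i`. -/
def piMap (i : ℕ) (f : C(X, Y)) (x : X) : HomotopyGroup.Pi i X x → HomotopyGroup.Pi i Y (f x) :=
  Quotient.map (genLoopMap f x) fun _ _ h => h.comp_continuousMap f

/-- A continuous map is `k`-connected, in the sense that it induces isomorphisms on `π_ i` for all
`0 ≤ i ≤ k` and all base points. (The induced maps are homomorphisms for `1 ≤ i`, so that being
an isomorphism means being bijective; `π_ 0` is the set of path components.) -/
def IsKConnectedMap (k : ℕ) (f : C(X, Y)) : Prop :=
  Function.Bijective (pi0Map f) ∧
    ∀ i : ℕ, 1 ≤ i → i ≤ k → ∀ x : X, Function.Bijective (piMap i f x)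

end Homotopy

/-! ### The regular hexagon -/

/-- The `k`-th vertex of the regular hexagon of radius `r` centred at the origin. -/
noncomputable def hexagonVertex (r : ℝ) (k : Fin 6) : EuclideanSpace ℝ (Fin 2) :=
  !₂[r * Real.cos ((k : ℕ) * (Real.pi / 3)), r * Real.sin ((k : ℕ) * (Real.pi / 3))]

/-- The set of the vertices of the regular hexagon of radius `r` centred at the origin. -/
noncomputable def regularHexagon (r : ℝ) : Finset (EuclideanSpace ℝ (Fin 2)) :=
  (Set.finite_range (hexagonVertex r)).toFinset

end RipsShadow

/-!
The vertices of the hexagon form three antipodal pairs, and two vertices are at distance at most `1`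
unless they are antipodal. So the Rips complex is the boundary of the octahedron, whose realization
is the unit sphere of the `ℓ¹` norm on `ℝ³`; the radial projection to the Euclidean sphere is a
homeomorphism.

If `u₀, u₁, u₂` are every second vertex of the hexagon, the projection to the plane sends `a` with
`|a₀| + |a₁| + |a₂| = 1` to `∑ aᵢ uᵢ`. As `∑ uᵢ = 0`, a constant may be added to the coordinates
of `a`. A point of the convex hull is `∑ aᵢ uᵢ` with `∑ |aᵢ| ≤ 1`, and by the intermediate value
theorem some constant brings the norm up to `1`; so the shadow is the whole hexagon.

Any two loops of dimension two with the same base point in a convex set are homotopic, so it remains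
to see that `π₂` of the octahedron is not trivial (`wrapLoop_not_homotopic_const`). This is done
with a combinatorial degree. A coarse labelling of a square by the six vertices, `wrapLabel`, wraps
the square once around the octahedron; a partition of unity turns it into a loop. A homotopy from
this loop to a constant map, sampled on a fine cubical grid, gives a labelling of the grid points
by vertices, each with a barycentric coordinate at least `1/6`, such that no cell has antipodal
labels. Evaluating a `2`-cocycle of the octahedron on the squares of the grid gives a divergence
free flux (`sum_squareFlux_eq_zero`), so the flux through the face that carries the loop vanishes.
But it does not change under refinement, and equals `1` for the coarse labelling
(`sum_squareFlux_refined`).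
-/

namespace RipsShadow

/-! ### A discrete degree for labellings by the vertices of the octahedron -/

/-- The signed indicator of the triangle `(0, true), (1, true), (2, true)`: a simplicial
`2`-cocycle on the octahedron that generates its second cohomology. It is written as the
determinant of the indicators of the three vertices of the triangle. -/
def triangleCocycle (x y z : Fin 3 × Bool) : ℤ :=
  let δ : Fin 3 → Fin 3 × Bool → ℤ := fun i v => if v = (i, true) then 1 else 0
  δ 0 x * (δ 1 y * δ 2 z - δ 2 y * δ 1 z) - δ 1 x * (δ 0 y * δ 2 z - δ 2 y * δ 0 z)
    + δ 2 x * (δ 0 y * δ 1 z - δ 1 y * δ 0 z)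

/-- Two vertices of the octahedron that are not antipodal; they may be equal. -/
def Compatible (x y : Fin 3 × Bool) : Prop := ¬ (x.1 = y.1 ∧ x.2 ≠ y.2)

instance (x y : Fin 3 × Bool) : Decidable (Compatible x y) := by
  unfold Compatible; infer_instance

theorem triangleCocycle_self_left (x y : Fin 3 × Bool) : triangleCocycle x x y = 0 := by
  simp only [triangleCocycle]; ring

theorem triangleCocycle_self_right (x y : Fin 3 × Bool) : triangleCocycle x y y = 0 := by
  simp only [triangleCocycle]; ring

set_option maxRecDepth 100000 in
/-- The cocycle condition: pairwise compatible vertices span a simplex, and the octahedron has no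
simplex with four vertices. -/
theorem triangleCocycle_coboundary : ∀ w x y z : Fin 3 × Bool, Compatible w x → Compatible w y →
    Compatible w z → Compatible x y → Compatible x z → Compatible y z →
    triangleCocycle x y z - triangleCocycle w y z + triangleCocycle w x z
      - triangleCocycle w x y = 0 := by
  decide

/-- The value of `triangleCocycle` on a square with corners `a, b, c, d` in cyclic order, cut into
two triangles along the diagonal `a c`. -/
def squareFlux (a b c d : Fin 3 × Bool) : ℤ := triangleCocycle a b c - triangleCocycle a d c

/-- The total flux out of a unit cube vanishes: cut the cube into the six tetrahedra
given by the monotone edge paths between two opposite corners, and use the cocycle condition. -/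
theorem squareFlux_cube (L : ℕ → ℕ → ℕ → Fin 3 × Bool) (i j k : ℕ)
    (h : ∀ i' ∈ Finset.Icc i (i + 1), ∀ j' ∈ Finset.Icc j (j + 1), ∀ k' ∈ Finset.Icc k (k + 1),
      ∀ i'' ∈ Finset.Icc i (i + 1), ∀ j'' ∈ Finset.Icc j (j + 1), ∀ k'' ∈ Finset.Icc k (k + 1),
      Compatible (L i' j' k') (L i'' j'' k'')) :
    (squareFlux (L (i+1) j k) (L (i+1) (j+1) k) (L (i+1) (j+1) (k+1)) (L (i+1) j (k+1))
      - squareFlux (L i j k) (L i (j+1) k) (L i (j+1) (k+1)) (L i j (k+1)))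
    - (squareFlux (L i (j+1) k) (L (i+1) (j+1) k) (L (i+1) (j+1) (k+1)) (L i (j+1) (k+1))
      - squareFlux (L i j k) (L (i+1) j k) (L (i+1) j (k+1)) (L i j (k+1)))
    + (squareFlux (L i j (k+1)) (L (i+1) j (k+1)) (L (i+1) (j+1) (k+1)) (L i (j+1) (k+1))
      - squareFlux (L i j k) (L (i+1) j k) (L (i+1) (j+1) k) (L i (j+1) k)) = 0 := by
  have tet : ∀ a₁ ∈ Finset.Icc i (i + 1), ∀ b₁ ∈ Finset.Icc j (j + 1),
      ∀ c₁ ∈ Finset.Icc k (k + 1), ∀ a₂ ∈ Finset.Icc i (i + 1), ∀ b₂ ∈ Finset.Icc j (j + 1),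
      ∀ c₂ ∈ Finset.Icc k (k + 1),
      triangleCocycle (L a₁ b₁ c₁) (L a₂ b₂ c₂) (L (i+1) (j+1) (k+1))
        - triangleCocycle (L i j k) (L a₂ b₂ c₂) (L (i+1) (j+1) (k+1))
        + triangleCocycle (L i j k) (L a₁ b₁ c₁) (L (i+1) (j+1) (k+1))
        - triangleCocycle (L i j k) (L a₁ b₁ c₁) (L a₂ b₂ c₂) = 0 := by
    intro a₁ ha₁ b₁ hb₁ c₁ hc₁ a₂ ha₂ b₂ hb₂ c₂ hc₂
    apply triangleCocycle_coboundary <;> apply h <;> first | assumption | simp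
  have t₁ := tet (i+1) (by simp) j (by simp) k (by simp) (i+1) (by simp) (j+1) (by simp) k (by simp)
  have t₂ := tet (i+1) (by simp) j (by simp) k (by simp) (i+1) (by simp) j (by simp) (k+1) (by simp)
  have t₃ := tet i (by simp) (j+1) (by simp) k (by simp) (i+1) (by simp) (j+1) (by simp) k (by simp)
  have t₄ := tet i (by simp) (j+1) (by simp) k (by simp) i (by simp) (j+1) (by simp) (k+1) (by simp)
  have t₅ := tet i (by simp) j (by simp) (k+1) (by simp) (i+1) (by simp) j (by simp) (k+1) (by simp)
  have t₆ := tet i (by simp) j (by simp) (k+1) (by simp) i (by simp) (j+1) (by simp) (k+1) (by simp)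
  simp only [squareFlux]
  linear_combination t₁ - t₂ - t₃ + t₄ + t₅ - t₆

/-- A discrete divergence theorem: if a labelling of a cubical grid has compatible labels in every
cell and is constant on all faces of the grid but `i = 0`, then the flux through this face
is zero. -/
theorem sum_squareFlux_eq_zero (N : ℕ) (L : ℕ → ℕ → ℕ → Fin 3 × Bool) (D : Fin 3 × Bool)
    (hL : ∀ i < N, ∀ j < N, ∀ k < N,
      ∀ i' ∈ Finset.Icc i (i + 1), ∀ j' ∈ Finset.Icc j (j + 1), ∀ k' ∈ Finset.Icc k (k + 1),
      ∀ i'' ∈ Finset.Icc i (i + 1), ∀ j'' ∈ Finset.Icc j (j + 1), ∀ k'' ∈ Finset.Icc k (k + 1),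
      Compatible (L i' j' k') (L i'' j'' k''))
    (hx : ∀ j ≤ N, ∀ k ≤ N, L N j k = D)
    (hy₀ : ∀ i ≤ N, ∀ k ≤ N, L i 0 k = D) (hy₁ : ∀ i ≤ N, ∀ k ≤ N, L i N k = D)
    (hz₀ : ∀ i ≤ N, ∀ j ≤ N, L i j 0 = D) (hz₁ : ∀ i ≤ N, ∀ j ≤ N, L i j N = D) :
    ∑ j ∈ Finset.range N, ∑ k ∈ Finset.range N,
      squareFlux (L 0 j k) (L 0 (j+1) k) (L 0 (j+1) (k+1)) (L 0 j (k+1)) = 0 := by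
  set Fx : ℕ → ℕ → ℕ → ℤ := fun i j k =>
    squareFlux (L i j k) (L i (j+1) k) (L i (j+1) (k+1)) (L i j (k+1)) with hFx
  set Fy : ℕ → ℕ → ℕ → ℤ := fun i j k =>
    squareFlux (L i j k) (L (i+1) j k) (L (i+1) j (k+1)) (L i j (k+1)) with hFy
  set Fz : ℕ → ℕ → ℕ → ℤ := fun i j k =>
    squareFlux (L i j k) (L (i+1) j k) (L (i+1) (j+1) k) (L i (j+1) k) with hFz
  have hconst : squareFlux D D D D = 0 := by
    simp [squareFlux]
  have key : ∑ i ∈ Finset.range N, ∑ j ∈ Finset.range N, ∑ k ∈ Finset.range N,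
      ((Fx (i+1) j k - Fx i j k) - (Fy i (j+1) k - Fy i j k) + (Fz i j (k+1) - Fz i j k)) = 0 :=
    Finset.sum_eq_zero fun i hi => Finset.sum_eq_zero fun j hj => Finset.sum_eq_zero fun k hk =>
      squareFlux_cube L i j k
        (hL i (Finset.mem_range.1 hi) j (Finset.mem_range.1 hj) k (Finset.mem_range.1 hk))
  simp only [Finset.sum_add_distrib, Finset.sum_sub_distrib] at key
  have ex : ∑ i ∈ Finset.range N, ∑ j ∈ Finset.range N, ∑ k ∈ Finset.range N,
      (Fx (i+1) j k - Fx i j k) = - ∑ j ∈ Finset.range N, ∑ k ∈ Finset.range N, Fx 0 j k := by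
    rw [Finset.sum_comm, ← Finset.sum_neg_distrib]
    refine Finset.sum_congr rfl fun j hj => ?_
    rw [Finset.sum_comm, ← Finset.sum_neg_distrib]
    refine Finset.sum_congr rfl fun k hk => ?_
    rw [Finset.mem_range] at hj hk
    rw [Finset.sum_range_sub (fun i => Fx i j k)]
    have : Fx N j k = 0 := by
      simp only [hFx]
      rw [hx j hj.le k hk.le, hx (j+1) hj k hk.le, hx (j+1) hj (k+1) hk, hx j hj.le (k+1) hk,
        hconst]
    rw [this, zero_sub]
  have ey : ∑ i ∈ Finset.range N, ∑ j ∈ Finset.range N, ∑ k ∈ Finset.range N,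
      (Fy i (j+1) k - Fy i j k) = 0 := by
    refine Finset.sum_eq_zero fun i hi => ?_
    rw [Finset.sum_comm]
    refine Finset.sum_eq_zero fun k hk => ?_
    rw [Finset.mem_range] at hi hk
    rw [Finset.sum_range_sub (fun j => Fy i j k)]
    simp only [hFy]
    rw [hy₁ i hi.le k hk.le, hy₁ (i+1) hi k hk.le, hy₁ (i+1) hi (k+1) hk, hy₁ i hi.le (k+1) hk,
      hy₀ i hi.le k hk.le, hy₀ (i+1) hi k hk.le, hy₀ (i+1) hi (k+1) hk, hy₀ i hi.le (k+1) hk,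
      sub_self]
  have ez : ∑ i ∈ Finset.range N, ∑ j ∈ Finset.range N, ∑ k ∈ Finset.range N,
      (Fz i j (k+1) - Fz i j k) = 0 := by
    refine Finset.sum_eq_zero fun i hi => Finset.sum_eq_zero fun j hj => ?_
    rw [Finset.mem_range] at hi hj
    rw [Finset.sum_range_sub (fun k => Fz i j k)]
    simp only [hFz]
    rw [hz₁ i hi.le j hj.le, hz₁ (i+1) hi j hj.le, hz₁ (i+1) hi (j+1) hj, hz₁ i hi.le (j+1) hj,
      hz₀ i hi.le j hj.le, hz₀ (i+1) hi j hj.le, hz₀ (i+1) hi (j+1) hj, hz₀ i hi.le (j+1) hj,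
      sub_self]
  simp only [Finset.sum_sub_distrib] at ex ey ez
  linarith

/-! ### A labelled square of degree one -/

/-- A labelling of the `5 × 5` grid, constant on its boundary, that wraps the square once around
the octahedron: the boundary goes to the vertex `(2, false)`, the centre to `(2, true)`, and the
ring in between winds once around the equator. -/
def wrapLabel : ℕ → ℕ → Fin 3 × Bool
  | 2, 2 => (2, true)
  | 3, 2 => (0, true)
  | 3, 3 => (0, true)
  | 2, 3 => (1, true)
  | 1, 3 => (1, true)
  | 1, 2 => (0, false)
  | 1, 1 => (0, false)
  | 2, 1 => (1, false)
  | 3, 1 => (1, false)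
  | _, _ => (2, false)

theorem wrapLabel_compatible : ∀ a b a' b' : Fin 5,
    (a : ℕ) ≤ a' + 1 ∧ (a' : ℕ) ≤ a + 1 ∧ (b : ℕ) ≤ b' + 1 ∧ (b' : ℕ) ≤ b + 1 →
    Compatible (wrapLabel a b) (wrapLabel a' b') := by
  decide

theorem wrapLabel_eq_or : ∀ a b : Fin 5, wrapLabel a b = (2, false) ∨
    (1 ≤ (a : ℕ) ∧ (a : ℕ) ≤ 3 ∧ 1 ≤ (b : ℕ) ∧ (b : ℕ) ≤ 3) := by
  decide

theorem sum_squareFlux_wrapLabel : ∑ a ∈ Finset.Ico 0 4, ∑ b ∈ Finset.Ico 0 4,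
    squareFlux (wrapLabel a b) (wrapLabel (a+1) b) (wrapLabel (a+1) (b+1)) (wrapLabel a (b+1))
      = 1 := by
  decide

/-- Reindexing of a sum along a monotone sequence with steps `0` and `1`. -/
theorem sum_range_step (T : ℕ → ℕ → ℤ) (hT : ∀ a, T a a = 0) (g : ℕ → ℕ)
    (hg : ∀ n, g (n + 1) = g n ∨ g (n + 1) = g n + 1) (N : ℕ) :
    ∑ n ∈ Finset.range N, T (g n) (g (n + 1)) = ∑ a ∈ Finset.Ico (g 0) (g N), T a (a + 1) := by
  have hmono : Monotone g := monotone_nat_of_le_succ fun n => by rcases hg n with h | h <;> omega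
  induction N with
  | zero => simp
  | succ N ih =>
    rw [Finset.sum_range_succ, ih]
    rcases hg N with h | h
    · rw [h, hT, add_zero]
    · rw [h, Finset.sum_Ico_succ_top (hmono (Nat.zero_le N))]

/-- The flux of `wrapLabel` does not change under refinement of the grid. -/
theorem sum_squareFlux_refined (g : ℕ → ℕ) (hg : ∀ n, g (n + 1) = g n ∨ g (n + 1) = g n + 1)
    (N : ℕ) (h0 : g 0 = 0) (hN : g N = 4) :
    ∑ j ∈ Finset.range N, ∑ k ∈ Finset.range N,
      squareFlux (wrapLabel (g j) (g k)) (wrapLabel (g (j+1)) (g k))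
        (wrapLabel (g (j+1)) (g (k+1))) (wrapLabel (g j) (g (k+1))) = 1 := by
  rw [← sum_squareFlux_wrapLabel]
  have h := sum_range_step (fun a a' => ∑ b ∈ Finset.Ico 0 4,
    squareFlux (wrapLabel a b) (wrapLabel a' b) (wrapLabel a' (b+1)) (wrapLabel a (b+1)))
    (fun a => Finset.sum_eq_zero fun b _ => by
      simp [squareFlux, triangleCocycle_self_left, triangleCocycle_self_right]) g hg N
  rw [h0, hN] at h
  rw [← h]
  refine Finset.sum_congr rfl fun j _ => ?_
  have h' := sum_range_step (fun b b' => squareFlux (wrapLabel (g j) b) (wrapLabel (g (j+1)) b)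
    (wrapLabel (g (j+1)) b') (wrapLabel (g j) b'))
    (fun b => by simp [squareFlux, triangleCocycle_self_left, triangleCocycle_self_right]) g hg N
  rw [h0, hN] at h'
  exact h'

/-! ### An essential loop of dimension two in the octahedron -/

open scoped unitInterval Topology Topology.Homotopy

theorem mem_realization_octahedron_iff {w : Fin 3 × Bool → ℝ} :
    w ∈ realization octahedron ↔
      w ∈ stdSimplex ℝ (Fin 3 × Bool) ∧ ∀ x y, w x ≠ 0 → w y ≠ 0 → Compatible x y := by
  constructor
  · rintro ⟨hw, s, hs, hws⟩
    refine ⟨hw, ?_⟩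
    rintro ⟨i, a⟩ ⟨j, b⟩ hx hy ⟨h₁, h₂⟩
    obtain rfl : i = j := h₁
    have hx' : (i, a) ∈ s := by_contra fun h => hx (hws _ h)
    have hy' : (i, b) ∈ s := by_contra fun h => hy (hws _ h)
    cases a <;> cases b <;> simp at h₂
    exacts [hs.2 i ⟨hy', hx'⟩, hs.2 i ⟨hx', hy'⟩]
  · rintro ⟨hw, h⟩
    classical
    refine ⟨hw, Finset.univ.filter fun v => w v ≠ 0, ⟨?_, fun i hi => ?_⟩, fun v hv => ?_⟩
    · by_contra hne
      rw [Finset.not_nonempty_iff_eq_empty, Finset.filter_eq_empty_iff] at hne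
      have : ∑ v, w v = 0 := Finset.sum_eq_zero fun v hv => not_not.1 (hne hv)
      rw [hw.2] at this
      exact one_ne_zero this
    · simp only [Finset.mem_filter, Finset.mem_univ, true_and] at hi
      exact h _ _ hi.1 hi.2 ⟨rfl, by simp⟩
    · simpa using hv

/-- A continuous step from `0` to `1` along the unit interval. -/
noncomputable def ramp (z : ℝ) : ℝ := max 0 (min 1 z)

theorem continuous_ramp : Continuous ramp := by unfold ramp; fun_prop

theorem ramp_mono : Monotone ramp := fun _ _ h => max_le_max le_rfl (min_le_min le_rfl h)

theorem ramp_of_nonpos {z : ℝ} (h : z ≤ 0) : ramp z = 0 :=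
  max_eq_left ((min_le_right _ _).trans h)

theorem ramp_of_one_le {z : ℝ} (h : 1 ≤ z) : ramp z = 1 := by
  rw [ramp, min_eq_left h, max_eq_right zero_le_one]

theorem ramp_of_mem {z : ℝ} (h₀ : 0 ≤ z) (h₁ : z ≤ 1) : ramp z = z := by
  rw [ramp, min_eq_right h₁, max_eq_right h₀]

/-- The piecewise linear hat function on `[0, 1]` with peak at `k / 4`. -/
noncomputable def hat (k : ℕ) (x : ℝ) : ℝ := ramp (4 * x - k + 1) - ramp (4 * x - k)

theorem continuous_hat (k : ℕ) : Continuous (hat k) := by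
  unfold hat
  have := continuous_ramp
  fun_prop

theorem hat_nonneg (k : ℕ) (x : ℝ) : 0 ≤ hat k x := sub_nonneg.2 (ramp_mono (by linarith))

theorem hat_eq_zero {k : ℕ} {x : ℝ} (h : 1 ≤ |4 * x - k|) : hat k x = 0 := by
  rcases le_abs'.1 h with h | h
  · rw [hat, ramp_of_nonpos (by linarith), ramp_of_nonpos (by linarith), sub_self]
  · rw [hat, ramp_of_one_le (by linarith), ramp_of_one_le (by linarith), sub_self]

theorem abs_lt_of_hat_ne_zero {k : ℕ} {x : ℝ} (h : hat k x ≠ 0) : |4 * x - k| < 1 :=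
  lt_of_not_ge fun h' => h (hat_eq_zero h')

theorem half_le_hat {k : ℕ} {x : ℝ} (h : |4 * x - k| ≤ 1 / 2) : 1 / 2 ≤ hat k x := by
  obtain ⟨h₁, h₂⟩ := abs_le.1 h
  rcases le_total 0 (4 * x - k) with h₀ | h₀
  · rw [hat, ramp_of_one_le (by linarith), ramp_of_mem h₀ (by linarith)]
    linarith
  · rw [hat, ramp_of_nonpos h₀, ramp_of_mem (by linarith) (by linarith)]
    linarith

theorem sum_hat {x : ℝ} (h₀ : 0 ≤ x) (h₁ : x ≤ 1) : ∑ k : Fin 5, hat k x = 1 := by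
  have h := Finset.sum_range_sub' (fun k : ℕ => ramp (4 * x - k + 1)) 5
  rw [Fin.sum_univ_eq_sum_range (fun k => hat k x) 5]
  have e : ∀ k : ℕ, hat k x = ramp (4 * x - k + 1) - ramp (4 * x - (k + 1 : ℕ) + 1) := by
    intro k
    rw [hat]
    push_cast
    congr 2
    ring
  simp only [e]
  rw [h, ramp_of_one_le, ramp_of_nonpos] <;> push_cast <;> linarith

/-- The barycentric coordinates of the map of the square to the octahedron that interpolates
`wrapLabel` by means of the partition of unity given by the products of hat functions. -/
noncomputable def wrapWeight (x y : ℝ) (v : Fin 3 × Bool) : ℝ :=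
  ∑ a : Fin 5, ∑ b : Fin 5, if wrapLabel a b = v then hat a x * hat b y else 0

theorem continuous_wrapWeight (v : Fin 3 × Bool) :
    Continuous fun p : ℝ × ℝ => wrapWeight p.1 p.2 v := by
  unfold wrapWeight
  refine continuous_finsetSum _ fun a _ => continuous_finsetSum _ fun b _ => ?_
  split_ifs
  · exact ((continuous_hat a).comp continuous_fst).mul ((continuous_hat b).comp continuous_snd)
  · exact continuous_const

theorem hat_mul_hat_le_wrapWeight (x y : ℝ) (a b : Fin 5) :
    hat a x * hat b y ≤ wrapWeight x y (wrapLabel a b) := by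
  have hnn : ∀ a' b' : Fin 5,
      0 ≤ if wrapLabel a' b' = wrapLabel a b then hat a' x * hat b' y else 0 := by
    intro a' b'
    split_ifs
    exacts [mul_nonneg (hat_nonneg _ _) (hat_nonneg _ _), le_rfl]
  calc hat a x * hat b y = if wrapLabel a b = wrapLabel a b then hat a x * hat b y else 0 := by
        rw [if_pos rfl]
    _ ≤ ∑ b' : Fin 5, if wrapLabel a b' = wrapLabel a b then hat a x * hat b' y else 0 :=
        Finset.single_le_sum (f := fun b' : Fin 5 =>
          if wrapLabel a b' = wrapLabel a b then hat a x * hat b' y else 0)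
          (fun b' _ => hnn a b') (Finset.mem_univ b)
    _ ≤ _ := Finset.single_le_sum (f := fun a' : Fin 5 => ∑ b' : Fin 5,
          if wrapLabel a' b' = wrapLabel a b then hat a' x * hat b' y else 0)
          (fun a' _ => Finset.sum_nonneg fun b' _ => hnn a' b') (Finset.mem_univ a)

theorem exists_of_wrapWeight_ne_zero {x y : ℝ} {v : Fin 3 × Bool} (h : wrapWeight x y v ≠ 0) :
    ∃ a b : Fin 5, wrapLabel a b = v ∧ hat a x ≠ 0 ∧ hat b y ≠ 0 := by
  obtain ⟨a, -, ha⟩ := Finset.exists_ne_zero_of_sum_ne_zero h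
  obtain ⟨b, -, hb⟩ := Finset.exists_ne_zero_of_sum_ne_zero ha
  split_ifs at hb with hv
  · exact ⟨a, b, hv, left_ne_zero_of_mul hb, right_ne_zero_of_mul hb⟩
  · exact absurd rfl hb

theorem sum_wrapWeight {x y : ℝ} (hx₀ : 0 ≤ x) (hx₁ : x ≤ 1) (hy₀ : 0 ≤ y) (hy₁ : y ≤ 1) :
    ∑ v, wrapWeight x y v = 1 := by
  unfold wrapWeight
  rw [Finset.sum_comm]
  have : ∀ a : Fin 5, ∑ v, ∑ b : Fin 5, (if wrapLabel a b = v then hat a x * hat b y else 0)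
      = hat a x := by
    intro a
    rw [Finset.sum_comm]
    simp only [Finset.sum_ite_eq, Finset.mem_univ, if_true]
    rw [← Finset.mul_sum, sum_hat hy₀ hy₁, mul_one]
  simp only [this, sum_hat hx₀ hx₁]

theorem near_of_hat_ne_zero {a b : ℕ} {x : ℝ} (ha : hat a x ≠ 0) (hb : hat b x ≠ 0) :
    a ≤ b + 1 ∧ b ≤ a + 1 := by
  have h₁ := abs_lt.1 (abs_lt_of_hat_ne_zero ha)
  have h₂ := abs_lt.1 (abs_lt_of_hat_ne_zero hb)
  have h₃ : (a : ℝ) < (b + 2 : ℕ) := by push_cast; linarith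
  have h₄ : (b : ℝ) < (a + 2 : ℕ) := by push_cast; linarith
  rw [Nat.cast_lt] at h₃ h₄
  omega

theorem wrapWeight_mem_realization {x y : ℝ} (hx₀ : 0 ≤ x) (hx₁ : x ≤ 1) (hy₀ : 0 ≤ y)
    (hy₁ : y ≤ 1) : wrapWeight x y ∈ realization octahedron := by
  refine mem_realization_octahedron_iff.2
    ⟨⟨fun v => ?_, sum_wrapWeight hx₀ hx₁ hy₀ hy₁⟩, fun v v' hv hv' => ?_⟩
  · refine Finset.sum_nonneg fun a _ => Finset.sum_nonneg fun b _ => ?_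
    split_ifs
    exacts [mul_nonneg (hat_nonneg _ _) (hat_nonneg _ _), le_rfl]
  · obtain ⟨a, b, rfl, ha, hb⟩ := exists_of_wrapWeight_ne_zero hv
    obtain ⟨a', b', rfl, ha', hb'⟩ := exists_of_wrapWeight_ne_zero hv'
    have h₁ := near_of_hat_ne_zero ha ha'
    have h₂ := near_of_hat_ne_zero hb hb'
    exact wrapLabel_compatible a b a' b' ⟨h₁.1, h₁.2, h₂.1, h₂.2⟩

/-- The vertex of the octahedron that `wrapLabel` takes on the boundary, as a point. -/
noncomputable def octahedronBase : realization octahedron :=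
  ⟨Pi.single (2, false) 1, mem_realization_octahedron_iff.2
    ⟨single_mem_stdSimplex ℝ _, fun x y hx hy => by
      have h : ∀ z, (Pi.single (2, false) 1 : Fin 3 × Bool → ℝ) z ≠ 0 → z = (2, false) :=
        fun z hz => by_contra fun h => hz (Pi.single_eq_of_ne h _)
      rw [h x hx, h y hy]
      exact fun h' => h'.2 rfl⟩⟩

theorem wrapWeight_boundary {x y : ℝ} (hx₀ : 0 ≤ x) (hx₁ : x ≤ 1) (hy₀ : 0 ≤ y)
    (hy₁ : y ≤ 1) (h : (x = 0 ∨ x = 1) ∨ (y = 0 ∨ y = 1)) :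
    wrapWeight x y = Pi.single (2, false) 1 := by
  have hvan : ∀ (k : ℕ) (z : ℝ), 1 ≤ k → k ≤ 3 → z = 0 ∨ z = 1 → hat k z = 0 := by
    intro k z h₁ h₃ hz
    have h₁' : (1 : ℝ) ≤ k := by exact_mod_cast h₁
    have h₃' : (k : ℝ) ≤ 3 := by exact_mod_cast h₃
    apply hat_eq_zero
    rw [le_abs']
    rcases hz with rfl | rfl
    · left; linarith
    · right; linarith
  have h0 : ∀ v, v ≠ (2, false) → wrapWeight x y v = 0 := by
    intro v hv
    by_contra hne
    obtain ⟨a, b, rfl, ha, hb⟩ := exists_of_wrapWeight_ne_zero hne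
    rcases wrapLabel_eq_or a b with h' | ⟨h₁, h₂, h₃, h₄⟩
    · exact hv h'
    · rcases h with h | h
      · exact ha (hvan a x h₁ h₂ h)
      · exact hb (hvan b y h₃ h₄ h)
  have hs := sum_wrapWeight hx₀ hx₁ hy₀ hy₁
  rw [Finset.sum_eq_single (2, false) (fun v _ hv => h0 v hv) (fun h => absurd (Finset.mem_univ _) h)]
    at hs
  ext v
  by_cases hv : v = (2, false)
  · rw [hv, hs, Pi.single_eq_same]
  · rw [h0 v hv, Pi.single_eq_of_ne hv]

/-- The two-dimensional loop in the octahedron that interpolates `wrapLabel`. -/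
noncomputable def wrapLoop : GenLoop (Fin 2) (realization octahedron) octahedronBase :=
  ⟨⟨fun p => ⟨wrapWeight (p 0) (p 1), wrapWeight_mem_realization (p 0).2.1 (p 0).2.2 (p 1).2.1
      (p 1).2.2⟩, by
    refine Continuous.subtype_mk (continuous_pi fun v => ?_) _
    exact (continuous_wrapWeight v).comp (f := fun p : Fin 2 → I => ((p 0 : ℝ), (p 1 : ℝ)))
      (by fun_prop)⟩, by
    rintro p ⟨i, hi⟩
    refine Subtype.ext (wrapWeight_boundary (p 0).2.1 (p 0).2.2 (p 1).2.1 (p 1).2.2 ?_)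
    have hi' : (p i : ℝ) = 0 ∨ (p i : ℝ) = 1 := by
      rcases hi with h | h <;> simp [h]
    fin_cases i
    exacts [Or.inl hi', Or.inr hi']⟩

/-- The point `i / N` of the unit interval, for `i ≤ N`. -/
noncomputable def gridPoint (N i : ℕ) : I :=
  ⟨min (i / N) 1, le_min (by positivity) zero_le_one, min_le_right _ _⟩

theorem coe_gridPoint {N i : ℕ} (h : i ≤ N) : (gridPoint N i : ℝ) = i / N :=
  min_eq_left (div_le_one_of_le₀ (by exact_mod_cast h) (by positivity))

theorem gridPoint_zero (N : ℕ) : gridPoint N 0 = 0 := by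
  apply Subtype.ext
  rw [coe_gridPoint (Nat.zero_le N)]
  simp

theorem gridPoint_self {N : ℕ} (hN : 0 < N) : gridPoint N N = 1 := by
  apply Subtype.ext
  rw [coe_gridPoint le_rfl, div_self (by positivity)]
  rfl

theorem dist_gridPoint_le {N i a b : ℕ} (hi : i < N) (ha : a ∈ Finset.Icc i (i + 1))
    (hb : b ∈ Finset.Icc i (i + 1)) : dist (gridPoint N a) (gridPoint N b) ≤ 1 / N := by
  rw [Finset.mem_Icc] at ha hb
  rw [Subtype.dist_eq, coe_gridPoint (by omega), coe_gridPoint (by omega), Real.dist_eq,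
    ← sub_div, abs_div, Nat.abs_cast]
  gcongr
  have h₁ : (a : ℝ) ≤ b + 1 := by exact_mod_cast (by omega : a ≤ b + 1)
  have h₂ : (b : ℝ) ≤ a + 1 := by exact_mod_cast (by omega : b ≤ a + 1)
  rw [abs_le]
  constructor <;> linarith

/-- Some barycentric coordinate with respect to the six vertices is at least the average. -/
theorem exists_sixth_le {w : Fin 3 × Bool → ℝ} (hw : ∑ v, w v = 1) : ∃ v, 1 / 6 ≤ w v := by
  by_contra! h
  have : ∑ v, w v < ∑ _v : Fin 3 × Bool, (1 / 6 : ℝ) :=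
    Finset.sum_lt_sum_of_nonempty Finset.univ_nonempty fun v _ => h v
  rw [hw] at this
  norm_num at this

/-- `π₂` of the octahedron is not trivial. A homotopy from `wrapLoop` to a constant map, sampled
on a fine grid, would give a labelling of the cube by dominant vertices that contradicts
the discrete divergence theorem, as the flux through the face of `wrapLoop` is one. -/
theorem wrapLoop_not_homotopic_const : ¬ GenLoop.Homotopic wrapLoop GenLoop.const := by
  rintro ⟨H⟩
  set W : I × (Fin 2 → I) → Fin 3 × Bool → ℝ := fun p => (H p).1 with hW
  have hWc : Continuous W := continuous_subtype_val.comp H.continuous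
  have hWmem : ∀ p, W p ∈ realization octahedron := fun p => (H p).2
  obtain ⟨δ, hδ, hWδ⟩ := Metric.uniformContinuous_iff.1
    (CompactSpace.uniformContinuous_of_continuous hWc) (1 / 6) (by norm_num)
  obtain ⟨m, hm⟩ := exists_nat_one_div_lt hδ
  -- A multiple of `8`, so that the peaks of the hats and the points midway between them are grid
  -- points.
  set M : ℕ := m + 1 with hM
  set N : ℕ := 8 * M with hN
  have hMpos : 0 < M := Nat.succ_pos m
  have hNpos : 0 < N := by omega
  have hMR : (0 : ℝ) < M := by exact_mod_cast hMpos
  have hNδ : 1 / (N : ℝ) < δ := by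
    refine lt_of_le_of_lt ?_ hm
    have : ((m : ℝ) + 1) = (M : ℝ) := by rw [hM]; push_cast; ring
    rw [this]
    apply one_div_le_one_div_of_le hMR
    exact_mod_cast (by omega : M ≤ N)
  -- The index of the hat function whose peak is nearest to `i / N`.
  set g : ℕ → ℕ := fun i => (i + M) / (2 * M) with hg
  have hg_le : ∀ i, g i * (2 * M) ≤ i + M := fun i => Nat.div_mul_le_self _ _
  have hlt_g : ∀ i, i + M < (g i + 1) * (2 * M) := fun i =>
    (Nat.div_lt_iff_lt_mul (by omega)).1 (Nat.lt_succ_self _)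
  have hg0 : g 0 = 0 := by
    simp only [hg]
    exact Nat.div_eq_of_lt (by omega)
  have hgN : g N = 4 := by
    simp only [hg, hN]
    rw [Nat.div_eq_iff (by omega)]
    omega
  have hg_step : ∀ i, g (i + 1) = g i ∨ g (i + 1) = g i + 1 := by
    intro i
    simp only [hg]
    rw [show i + 1 + M = (i + M) + 1 by ring, Nat.succ_div]
    split_ifs
    exacts [Or.inr rfl, Or.inl rfl]
  have hg5 : ∀ i ≤ N, g i < 5 := by
    intro i hi
    have : g i ≤ g N := Nat.div_le_div_right (by omega)
    omega
  have hhat : ∀ i ≤ N, 1 / 2 ≤ hat (g i) (gridPoint N i) := by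
    intro i hi
    apply half_le_hat
    have h₁ : (g i : ℝ) * (2 * M) ≤ i + M := by exact_mod_cast hg_le i
    have h₂ : (i : ℝ) + M < (g i + 1) * (2 * M) := by exact_mod_cast hlt_g i
    have e : 4 * (gridPoint N i : ℝ) - g i = (i - g i * (2 * M)) / (2 * M) := by
      rw [coe_gridPoint hi, hN]
      push_cast
      field_simp
      ring
    rw [e, abs_div, abs_of_pos (by positivity : (0 : ℝ) < 2 * M), div_le_iff₀ (by positivity),
      abs_le]
    constructor <;> linarith
  set P : ℕ → ℕ → ℕ → I × (Fin 2 → I) := fun i j k =>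
    (gridPoint N i, ![gridPoint N j, gridPoint N k]) with hP
  choose lab hlab using fun p => exists_sixth_le (hWmem p).1.2
  -- On the face of `wrapLoop` the labels are prescribed, so that its flux can be computed; any label
  -- with a large coordinate does elsewhere.
  set L : ℕ → ℕ → ℕ → Fin 3 × Bool := fun i j k =>
    if i = 0 then wrapLabel (g j) (g k) else lab (P i j k) with hL
  have hL6 : ∀ i ≤ N, ∀ j ≤ N, ∀ k ≤ N, 1 / 6 ≤ W (P i j k) (L i j k) := by
    intro i hi j hj k hk
    rcases Nat.eq_zero_or_pos i with rfl | hi0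
    · have h := hat_mul_hat_le_wrapWeight (gridPoint N j) (gridPoint N k) ⟨g j, hg5 j hj⟩
        ⟨g k, hg5 k hk⟩
      have h₁ := hhat j hj
      have h₂ := hhat k hk
      have e : W (P 0 j k) = wrapWeight (gridPoint N j) (gridPoint N k) := by
        simp only [hW, hP, gridPoint_zero]
        rw [H.apply_zero]
        rfl
      rw [e]
      simp only [hL, if_true]
      refine le_trans ?_ h
      simp only
      nlinarith
    · simp only [hL, hi0.ne', if_false]
      exact hlab _
  have hbase : ∀ i ≤ N, ∀ j ≤ N, ∀ k ≤ N, H (P i j k) = octahedronBase →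
      L i j k = (2, false) := by
    intro i hi j hj k hk h
    have h6 := hL6 i hi j hj k hk
    by_contra hne
    have : W (P i j k) (L i j k) = 0 := by
      change (H (P i j k)).1 _ = 0
      rw [h]
      exact Pi.single_eq_of_ne hne _
    rw [this] at h6
    norm_num at h6
  have hbd : ∀ i j k, ![gridPoint N j, gridPoint N k] ∈ Cube.boundary (Fin 2) →
      H (P i j k) = octahedronBase := by
    intro i j k h
    have := H.eq_snd (gridPoint N i) h
    exact this
  have hzero := sum_squareFlux_eq_zero N L (2, false) ?_ ?_ ?_ ?_ ?_ ?_
  · have hone := sum_squareFlux_refined g hg_step N hg0 hgN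
    have : (0 : ℤ) = 1 := hzero.symm.trans hone
    norm_num at this
  · intro i hi j hj k hk i' hi' j' hj' k' hk' i'' hi'' j'' hj'' k'' hk''
    have hd : dist (P i' j' k') (P i'' j'' k'') < δ := by
      refine lt_of_le_of_lt ?_ hNδ
      simp only [hP]
      rw [Prod.dist_eq, max_le_iff]
      refine ⟨dist_gridPoint_le hi hi' hi'', (dist_pi_le_iff (by positivity)).2 fun l => ?_⟩
      fin_cases l
      exacts [dist_gridPoint_le hj hj' hj'', dist_gridPoint_le hk hk' hk'']
    have hWd := hWδ hd
    -- Both labels have positive coordinates at the second point, so they span a simplex.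
    rw [Finset.mem_Icc] at hi' hj' hk' hi'' hj'' hk''
    have h6 := hL6 i' (by omega) j' (by omega) k' (by omega)
    have h6' := hL6 i'' (by omega) j'' (by omega) k'' (by omega)
    refine (mem_realization_octahedron_iff.1 (hWmem (P i'' j'' k''))).2 _ _ ?_ (by linarith)
    have := (dist_le_pi_dist (W (P i' j' k')) (W (P i'' j'' k'')) (L i' j' k')).trans_lt hWd
    rw [Real.dist_eq, abs_lt] at this
    linarith [this.2]
  · intro j hj k hk
    refine hbase N le_rfl j hj k hk ?_
    simp only [hP, gridPoint_self hNpos]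
    exact H.apply_one _
  · exact fun i hi k hk => hbase i hi 0 (Nat.zero_le _) k hk
      (hbd i 0 k ⟨0, Or.inl (gridPoint_zero N)⟩)
  · exact fun i hi k hk => hbase i hi N le_rfl k hk
      (hbd i N k ⟨0, Or.inr (gridPoint_self hNpos)⟩)
  · exact fun i hi j hj => hbase i hi j hj 0 (Nat.zero_le _)
      (hbd i j 0 ⟨1, Or.inl (gridPoint_zero N)⟩)
  · exact fun i hi j hj => hbase i hi j hj N le_rfl
      (hbd i j N ⟨1, Or.inr (gridPoint_self hNpos)⟩)

/-! ### Maps onto convex sets -/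

/-- Maps into a convex set that agree on a set are homotopic relative to it. -/
theorem homotopicRel_of_convex {A E : Type*} [TopologicalSpace A] [NormedAddCommGroup E]
    [NormedSpace ℝ E] {s : Set E} (hs : Convex ℝ s) (f g : C(A, s)) (B : Set A)
    (h : ∀ b ∈ B, f b = g b) : f.HomotopicRel g B :=
  ⟨{  toFun := fun p => ⟨AffineMap.lineMap (f p.2 : E) (g p.2 : E) (p.1 : ℝ),
        hs.lineMap_mem (f p.2).2 (g p.2).2 p.1.2⟩
      continuous_toFun := by
        refine Continuous.subtype_mk ?_ _
        simp only [AffineMap.lineMap_apply_module]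
        fun_prop
      map_zero_left := fun a => by simp
      map_one_left := fun a => by simp
      prop' := fun t b hb => by
        apply Subtype.ext
        simp [h b hb] }⟩

/-- A map from a space homeomorphic to the octahedron to a convex set is not `2`-connected, as it
annihilates the nontrivial second homotopy group. -/
theorem not_isKConnectedMap_of_convex {A E : Type*} [TopologicalSpace A] [NormedAddCommGroup E]
    [NormedSpace ℝ E] {s : Set E} (hs : Convex ℝ s) (e : realization octahedron ≃ₜ A)
    (f : C(A, s)) : ¬ IsKConnectedMap 2 f := by
  intro hf
  have hinj := (hf.2 2 one_le_two le_rfl (e octahedronBase)).1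
  let q := genLoopMap (e : C(realization octahedron, A)) octahedronBase wrapLoop
  let c := genLoopMap (e : C(realization octahedron, A)) octahedronBase
    (GenLoop.const : GenLoop (Fin 2) _ octahedronBase)
  have hqc : (Quotient.mk (GenLoop.Homotopic.setoid _ _) q : HomotopyGroup.Pi 2 A _) =
      Quotient.mk (GenLoop.Homotopic.setoid _ _) c := by
    apply hinj
    refine Quotient.sound (homotopicRel_of_convex hs _ _ _ fun b hb => ?_)
    exact ((genLoopMap f _ q).2 b hb).trans ((genLoopMap f _ c).2 b hb).symm
  have hH : q.1.HomotopicRel c.1 (Cube.boundary (Fin 2)) := Quotient.exact hqc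
  have hH' := hH.comp_continuousMap (e.symm : C(A, realization octahedron))
  apply wrapLoop_not_homotopic_const
  have hcancel : ∀ r : C(Fin 2 → I, realization octahedron),
      (e.symm : C(A, realization octahedron)).comp ((e : C(realization octahedron, A)).comp r) = r :=
    fun r => ContinuousMap.ext fun p => e.symm_apply_apply _
  change ContinuousMap.HomotopicRel _ _ _
  rw [← hcancel wrapLoop.1,
    ← hcancel (GenLoop.const : GenLoop (Fin 2) (realization octahedron) octahedronBase).1]
  exact hH'

/-! ### The octahedron as a sphere -/

/-- An isomorphism of simplicial complexes induces a map of realizations. -/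
theorem comp_symm_mem_realization {V W : Type*} [Fintype V] [Fintype W]
    {K : AbstractSimplicialComplex V} {L : AbstractSimplicialComplex W} (e : V ≃ W)
    (h : ∀ s : Finset V, s ∈ K.faces → s.map e.toEmbedding ∈ L.faces) {w : V → ℝ}
    (hw : w ∈ realization K) : w ∘ e.symm ∈ realization L := by
  obtain ⟨⟨h₀, h₁⟩, s, hs, hws⟩ := hw
  refine ⟨⟨fun v => h₀ _, ?_⟩, s.map e.toEmbedding, h s hs, fun v hv => hws _ fun hv' => hv ?_⟩
  · rw [← h₁]
    exact Equiv.sum_comp e.symm w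
  · exact Finset.mem_map.2 ⟨_, hv', e.apply_symm_apply v⟩

/-- Isomorphic simplicial complexes have homeomorphic realizations. -/
def realizationHomeomorph {V W : Type*} [Fintype V] [Fintype W]
    {K : AbstractSimplicialComplex V} {L : AbstractSimplicialComplex W} (e : V ≃ W)
    (h : ∀ s : Finset V, s ∈ K.faces ↔ s.map e.toEmbedding ∈ L.faces) :
    realization K ≃ₜ realization L where
  toFun w := ⟨w.1 ∘ e.symm, comp_symm_mem_realization e (fun s => (h s).1) w.2⟩
  invFun w := ⟨w.1 ∘ e, comp_symm_mem_realization (K := L) (L := K) e.symm (fun s hs => by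
    rw [h, Finset.map_map]
    convert hs
    ext v
    simp) w.2⟩
  left_inv w := Subtype.ext (funext fun v => by simp)
  right_inv w := Subtype.ext (funext fun v => by simp)
  continuous_toFun := by
    refine Continuous.subtype_mk (continuous_pi fun v => ?_) _
    exact (continuous_apply (e.symm v)).comp continuous_subtype_val
  continuous_invFun := by
    refine Continuous.subtype_mk (continuous_pi fun v => ?_) _
    exact (continuous_apply (e v)).comp continuous_subtype_val

/-- The barycentric coordinates of the point of the octahedron with the coordinates `a`: the
positive and negative parts of the `a i`. -/
def signedWeight (a : Fin 3 → ℝ) (v : Fin 3 × Bool) : ℝ :=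
  if v.2 then max (a v.1) 0 else max (-a v.1) 0

theorem sum_prod_bool {M : Type*} [AddCommMonoid M] (f : Fin 3 × Bool → M) :
    ∑ v, f v = ∑ i, (f (i, true) + f (i, false)) := by
  rw [Fintype.sum_prod_type]
  simp

theorem signedWeight_true_add_false (a : Fin 3 → ℝ) (i : Fin 3) :
    signedWeight a (i, true) + signedWeight a (i, false) = |a i| := by
  simp only [signedWeight, if_true, Bool.false_eq_true, if_false]
  rcases le_total 0 (a i) with h | h
  · rw [max_eq_left h, max_eq_right (by linarith), abs_of_nonneg h, add_zero]
  · rw [max_eq_right h, max_eq_left (by linarith), abs_of_nonpos h, zero_add]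

theorem signedWeight_true_sub_false (a : Fin 3 → ℝ) (i : Fin 3) :
    signedWeight a (i, true) - signedWeight a (i, false) = a i := by
  simp only [signedWeight, if_true, Bool.false_eq_true, if_false]
  rcases le_total 0 (a i) with h | h
  · rw [max_eq_left h, max_eq_right (by linarith), sub_zero]
  · rw [max_eq_right h, max_eq_left (by linarith)]
    ring

theorem signedWeight_mem_realization {a : Fin 3 → ℝ} (ha : ∑ i, |a i| = 1) :
    signedWeight a ∈ realization octahedron := by
  refine mem_realization_octahedron_iff.2 ⟨⟨fun v => ?_, ?_⟩, ?_⟩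
  · unfold signedWeight
    split_ifs <;> exact le_max_right _ _
  · rw [sum_prod_bool]
    simp only [signedWeight_true_add_false, ha]
  · have h : ∀ i, signedWeight a (i, true) = 0 ∨ signedWeight a (i, false) = 0 := by
      intro i
      rcases le_total 0 (a i) with h | h
      · exact Or.inr (by simpa [signedWeight] using h)
      · exact Or.inl (by simpa [signedWeight] using h)
    rintro ⟨i, b⟩ ⟨j, c⟩ hx hy ⟨h₁, h₂⟩
    obtain rfl : i = j := h₁
    rcases h i with h | h <;> cases b <;> cases c <;> simp_all

theorem signedWeight_sub {w : Fin 3 × Bool → ℝ} (hw : w ∈ realization octahedron) :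
    signedWeight (fun i => w (i, true) - w (i, false)) = w := by
  obtain ⟨⟨h₀, -⟩, h⟩ := mem_realization_octahedron_iff.1 hw
  ext ⟨i, b⟩
  have h₁ := h₀ (i, true)
  have h₂ := h₀ (i, false)
  have h₃ : w (i, true) = 0 ∨ w (i, false) = 0 := by
    by_contra! hne
    exact h _ _ hne.1 hne.2 ⟨rfl, by simp⟩
  rcases h₃ with h₃ | h₃ <;> cases b <;> simp [signedWeight, h₃, h₁, h₂]

/-- The realization of the octahedron is the unit sphere of the `ℓ¹` norm. -/
def octahedronHomeomorph : realization octahedron ≃ₜ {a : Fin 3 → ℝ | ∑ i, |a i| = 1} where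
  toFun w := ⟨fun i => w.1 (i, true) - w.1 (i, false), by
    have h := w.2.1.2
    rw [← signedWeight_sub w.2, sum_prod_bool] at h
    simp only [signedWeight_true_add_false] at h
    exact h⟩
  invFun a := ⟨signedWeight a.1, signedWeight_mem_realization a.2⟩
  left_inv w := Subtype.ext (signedWeight_sub w.2)
  right_inv a := Subtype.ext (funext fun i => signedWeight_true_sub_false a.1 i)
  continuous_toFun := by
    refine Continuous.subtype_mk (continuous_pi fun i => ?_) _
    exact ((continuous_apply (i, true)).comp continuous_subtype_val).sub
      ((continuous_apply (i, false)).comp continuous_subtype_val)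
  continuous_invFun := by
    refine Continuous.subtype_mk (continuous_pi fun v => ?_) _
    unfold signedWeight
    have h := (continuous_apply (A := fun _ => ℝ) v.1).comp
      (continuous_subtype_val (p := fun a : Fin 3 → ℝ => ∑ i, |a i| = 1))
    split_ifs
    exacts [h.max continuous_const, h.neg.max continuous_const]

theorem sum_abs_pos {y : Fin 3 → ℝ} (hy : y ≠ 0) : 0 < ∑ i, |y i| := by
  obtain ⟨i, hi⟩ := Function.ne_iff.1 hy
  exact Finset.sum_pos' (fun _ _ => abs_nonneg _) ⟨i, Finset.mem_univ i, abs_pos.2 hi⟩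

/-- Radial projection from the unit sphere of the `ℓ¹` norm to the Euclidean unit sphere. -/
noncomputable def radialHomeomorph : {a : Fin 3 → ℝ | ∑ i, |a i| = 1} ≃ₜ
    Metric.sphere (0 : EuclideanSpace ℝ (Fin 3)) 1 := by
  have ha0 : ∀ a : {a : Fin 3 → ℝ | ∑ i, |a i| = 1}, ‖WithLp.toLp 2 a.1‖ ≠ 0 := by
    intro a h
    have ha := a.2
    rw [norm_eq_zero, WithLp.toLp_eq_zero] at h
    simp [h] at ha
  have hy0 : ∀ y : Metric.sphere (0 : EuclideanSpace ℝ (Fin 3)) 1, 0 < ∑ i, |y.1 i| := by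
    intro y
    apply sum_abs_pos
    intro h
    have hy : y.1 = 0 := by
      ext i
      exact congrFun h i
    have := y.2
    simp [hy] at this
  exact {
    toFun := fun a => ⟨‖WithLp.toLp 2 a.1‖⁻¹ • WithLp.toLp 2 a.1, by
      rw [mem_sphere_zero_iff_norm, norm_smul, norm_inv, norm_norm, inv_mul_cancel₀ (ha0 a)]⟩
    invFun := fun y => ⟨fun i => (∑ j, |y.1 j|)⁻¹ * y.1 i, by
      simp only [Set.mem_ofPred_eq, abs_mul, ← Finset.mul_sum]
      rw [abs_of_pos (inv_pos.2 (hy0 y)), inv_mul_cancel₀ (hy0 y).ne']⟩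
    left_inv := fun a => by
      have ha : ∑ i, |a.1 i| = 1 := a.2
      have h0 := ha0 a
      ext i
      simp only [PiLp.smul_apply, smul_eq_mul, abs_mul, ← Finset.mul_sum, ha, abs_inv, abs_norm]
      field_simp
    right_inv := fun y => by
      have hy : ‖y.1‖ = 1 := mem_sphere_zero_iff_norm.1 y.2
      have h0 := hy0 y
      have e : WithLp.toLp 2 (fun i => (∑ j, |y.1 j|)⁻¹ * y.1 i) = (∑ j, |y.1 j|)⁻¹ • y.1 := by
        ext i
        simp
      apply Subtype.ext
      simp only [e]
      rw [norm_smul, hy, mul_one, norm_inv, Real.norm_of_nonneg h0.le, inv_inv, smul_smul,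
        mul_inv_cancel₀ h0.ne', one_smul]
    continuous_toFun := by
      have h : Continuous fun a : {a : Fin 3 → ℝ | ∑ i, |a i| = 1} => WithLp.toLp 2 a.1 := by
        fun_prop
      exact Continuous.subtype_mk ((h.norm.inv₀ ha0).smul h) _
    continuous_invFun := by
      refine Continuous.subtype_mk (continuous_pi fun i => Continuous.mul ?_ (by fun_prop)) _
      exact Continuous.inv₀ (by fun_prop) fun y => (hy0 y).ne' }

/-! ### The Rips complex of the hexagon -/

/-- Every second vertex of the hexagon. -/
noncomputable def triangleVertex (r : ℝ) : Fin 3 → EuclideanSpace ℝ (Fin 2) :=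
  ![!₂[r, 0], !₂[-(r / 2), r * (√3 / 2)], !₂[-(r / 2), -(r * (√3 / 2))]]

/-- The vertices of the hexagon, labelled by the vertices of the octahedron: antipodal vertices
correspond to each other. -/
noncomputable def signedVertex (r : ℝ) (v : Fin 3 × Bool) : EuclideanSpace ℝ (Fin 2) :=
  if v.2 then triangleVertex r v.1 else -triangleVertex r v.1

theorem sum_triangleVertex (r : ℝ) : ∑ i, triangleVertex r i = 0 := by
  rw [Fin.sum_univ_three]
  ext j
  fin_cases j <;> simp [triangleVertex]
  ring

theorem norm_sq_triangleVertex (r : ℝ) (i : Fin 3) : ‖triangleVertex r i‖ ^ 2 = r ^ 2 := by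
  have h3 : √3 ^ 2 = (3 : ℝ) := Real.sq_sqrt (by norm_num)
  rw [EuclideanSpace.real_norm_sq_eq, Fin.sum_univ_two]
  fin_cases i <;> simp [triangleVertex] <;> linear_combination r ^ 2 / 4 * h3

theorem inner_triangleVertex (r : ℝ) {i j : Fin 3} (h : i ≠ j) :
    inner ℝ (triangleVertex r i) (triangleVertex r j) = -r ^ 2 / 2 := by
  have h3 : √3 ^ 2 = (3 : ℝ) := Real.sq_sqrt (by norm_num)
  rw [PiLp.inner_apply, Fin.sum_univ_two]
  fin_cases i <;> fin_cases j <;> simp [triangleVertex] at h ⊢ <;>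
    first | ring1 | linear_combination -r ^ 2 / 4 * h3 + 1 / 4 * sq_abs r

theorem dist_sq_signedVertex (r : ℝ) {i j : Fin 3} (h : i ≠ j) (a b : Bool) :
    dist (signedVertex r (i, a)) (signedVertex r (j, b)) ^ 2
      = if a = b then 3 * r ^ 2 else r ^ 2 := by
  have h₁ := norm_sq_triangleVertex r i
  have h₂ := norm_sq_triangleVertex r j
  have h₃ := inner_triangleVertex r h
  rw [dist_eq_norm, norm_sub_sq_real]
  cases a <;> cases b <;>
    simp only [signedVertex, if_true, Bool.false_eq_true, if_false, norm_neg, h₁, h₂,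
      inner_neg_left, inner_neg_right, h₃, Bool.true_eq_false] <;> ring

theorem signedVertex_opposite (r : ℝ) (i : Fin 3) (b : Bool) :
    signedVertex r (i, !b) = -signedVertex r (i, b) := by
  cases b <;> simp [signedVertex]

theorem dist_signedVertex_opposite {r : ℝ} (hr : 0 ≤ r) (i : Fin 3) (b : Bool) :
    dist (signedVertex r (i, b)) (signedVertex r (i, !b)) = 2 * r := by
  have h : ‖signedVertex r (i, b)‖ = r := by
    rw [← abs_of_nonneg hr, ← abs_norm, ← sq_eq_sq_iff_abs_eq_abs, abs_of_nonneg hr,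
      ← norm_sq_triangleVertex r i]
    cases b <;> simp [signedVertex]
  rw [signedVertex_opposite, dist_eq_norm, sub_neg_eq_add, ← two_smul ℝ, norm_smul, h]
  norm_num

theorem three_mul_sq_le {r : ℝ} (h₁ : 1 / 2 < r) (h₂ : r ≤ 1 / √3) : 3 * r ^ 2 ≤ 1 := by
  have h := pow_le_pow_left₀ (by linarith) h₂ 2
  rw [div_pow, one_pow, Real.sq_sqrt (by norm_num)] at h
  linarith

theorem dist_signedVertex_le_one_iff {r : ℝ} (h₁ : 1 / 2 < r) (h₂ : r ≤ 1 / √3)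
    (v w : Fin 3 × Bool) : dist (signedVertex r v) (signedVertex r w) ≤ 1 ↔ Compatible v w := by
  obtain ⟨i, a⟩ := v
  obtain ⟨j, b⟩ := w
  have h3 := three_mul_sq_le h₁ h₂
  by_cases hij : i = j
  · subst hij
    by_cases hab : a = b
    · subst hab
      simp [Compatible]
    · obtain rfl : b = !a := by cases a <;> cases b <;> simp_all
      rw [dist_signedVertex_opposite (by linarith)]
      simp only [Compatible, true_and, ne_eq, Bool.eq_not_self, not_false_eq_true, not_true,
        iff_false]
      linarith
  · refine iff_of_true ?_ fun h => hij h.1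
    rw [← abs_of_nonneg (dist_nonneg (x := signedVertex r (i, a)) (y := signedVertex r (j, b))),
      ← sq_le_one_iff_abs_le_one, dist_sq_signedVertex r hij]
    split_ifs <;> nlinarith

theorem signedVertex_injective {r : ℝ} (hr : 0 < r) : Function.Injective (signedVertex r) := by
  rintro ⟨i, a⟩ ⟨j, b⟩ h
  by_cases hij : i = j
  · subst hij
    by_cases hab : a = b
    · rw [hab]
    · obtain rfl : b = !a := by cases a <;> cases b <;> simp_all
      have := dist_signedVertex_opposite hr.le i a
      rw [h, dist_self] at this
      linarith
  · have := dist_sq_signedVertex r hij a b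
    rw [h, dist_self] at this
    have hr2 : 0 < r ^ 2 := by positivity
    split_ifs at this <;> linarith

theorem signedVertex_eq_hexagonVertex (r : ℝ) (v : Fin 3 × Bool) :
    signedVertex r v = hexagonVertex r
      (![![3, 0], ![5, 2], ![1, 4]] v.1 (if v.2 then 1 else 0)) := by
  have c2 : Real.cos (2 * (Real.pi / 3)) = -(1 / 2) := by
    rw [← Real.cos_pi_div_three, ← Real.cos_pi_sub]; congr 1; ring
  have s2 : Real.sin (2 * (Real.pi / 3)) = √3 / 2 := by
    rw [← Real.sin_pi_div_three, ← Real.sin_pi_sub]; congr 1; ring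
  have c3 : Real.cos (3 * (Real.pi / 3)) = -1 := by rw [← Real.cos_pi]; congr 1; ring
  have s3 : Real.sin (3 * (Real.pi / 3)) = 0 := by rw [← Real.sin_pi]; congr 1; ring
  have c4 : Real.cos (4 * (Real.pi / 3)) = -(1 / 2) := by
    rw [← Real.cos_pi_div_three, ← Real.cos_add_pi]; congr 1; ring
  have s4 : Real.sin (4 * (Real.pi / 3)) = -(√3 / 2) := by
    rw [← Real.sin_pi_div_three, ← Real.sin_add_pi]; congr 1; ring
  have c5 : Real.cos (5 * (Real.pi / 3)) = 1 / 2 := by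
    rw [← Real.cos_pi_div_three, ← Real.cos_two_pi_sub]; congr 1; ring
  have s5 : Real.sin (5 * (Real.pi / 3)) = -(√3 / 2) := by
    rw [← Real.sin_pi_div_three, ← Real.sin_two_pi_sub]; congr 1; ring
  obtain ⟨i, b⟩ := v
  ext j
  fin_cases i <;> cases b <;> fin_cases j <;>
    simp [signedVertex, triangleVertex, hexagonVertex, c2, s2, c3, s3, c4, s4, c5, s5] <;> ring

theorem mem_regularHexagon_iff {r : ℝ} {x : EuclideanSpace ℝ (Fin 2)} :
    x ∈ regularHexagon r ↔ ∃ v, signedVertex r v = x := by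
  rw [regularHexagon, Set.Finite.mem_toFinset]
  constructor
  · rintro ⟨k, rfl⟩
    refine ⟨![(0, true), (2, false), (1, true), (0, false), (2, true), (1, false)] k, ?_⟩
    rw [signedVertex_eq_hexagonVertex]
    fin_cases k <;> rfl
  · rintro ⟨v, rfl⟩
    exact ⟨_, (signedVertex_eq_hexagonVertex r v).symm⟩

/-- The bijection of the vertices of the octahedron with those of the hexagon. -/
noncomputable def hexagonEquiv {r : ℝ} (hr : 0 < r) : Fin 3 × Bool ≃ regularHexagon r :=
  Equiv.ofBijective (fun v => ⟨signedVertex r v, mem_regularHexagon_iff.2 ⟨v, rfl⟩⟩)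
    ⟨fun _ _ h => signedVertex_injective hr (congrArg Subtype.val h), fun x => by
      obtain ⟨v, hv⟩ := mem_regularHexagon_iff.1 x.2
      exact ⟨v, Subtype.ext hv⟩⟩

theorem coe_hexagonEquiv {r : ℝ} (hr : 0 < r) (v : Fin 3 × Bool) :
    (hexagonEquiv hr v : EuclideanSpace ℝ (Fin 2)) = signedVertex r v := rfl

theorem mem_octahedron_faces_iff {s : Finset (Fin 3 × Bool)} :
    s ∈ octahedron.faces ↔ s.Nonempty ∧ ∀ x ∈ s, ∀ y ∈ s, Compatible x y := by
  refine and_congr_right fun _ => ⟨?_, fun h i hi => h _ hi.1 _ hi.2 ⟨rfl, by simp⟩⟩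
  rintro h ⟨i, a⟩ hx ⟨j, b⟩ hy ⟨h₁, h₂⟩
  obtain rfl : i = j := h₁
  cases a <;> cases b <;> simp at h₂
  exacts [h i ⟨hy, hx⟩, h i ⟨hx, hy⟩]

theorem map_hexagonEquiv_mem_ripsComplex {r : ℝ} (h₁ : 1 / 2 < r) (h₂ : r ≤ 1 / √3)
    (hr : 0 < r) (s : Finset (Fin 3 × Bool)) : s ∈ octahedron.faces ↔
      s.map (hexagonEquiv hr).toEmbedding ∈ (ripsComplex (regularHexagon r)).faces := by
  rw [mem_octahedron_faces_iff]
  refine and_congr (by simp) ?_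
  simp only [Finset.forall_mem_map, Equiv.coe_toEmbedding, coe_hexagonEquiv,
    dist_signedVertex_le_one_iff h₁ h₂]

theorem simpliciallyIsomorphic_octahedron {r : ℝ} (h₁ : 1 / 2 < r) (h₂ : r ≤ 1 / √3) :
    SimpliciallyIsomorphic (ripsComplex (regularHexagon r)) octahedron := by
  have hr : 0 < r := by linarith
  refine ⟨(hexagonEquiv hr).symm, fun s => ?_⟩
  rw [map_hexagonEquiv_mem_ripsComplex h₁ h₂ hr, Finset.map_map]
  convert Iff.rfl
  ext v
  simp

theorem adjacent_ripsComplex_iff {n : ℕ} {X : Finset (EuclideanSpace ℝ (Fin n))} {x y : X} :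
    Adjacent (ripsComplex X) x y ↔
      x ≠ y ∧ dist (x : EuclideanSpace ℝ (Fin n)) (y : EuclideanSpace ℝ (Fin n)) ≤ 1 := by
  classical
  refine and_congr_right fun _ => ⟨fun ⟨s, hs, hx, hy⟩ => hs.2 x hx y hy, fun h => ?_⟩
  refine ⟨{x, y}, ⟨Finset.insert_nonempty _ _, fun a ha b hb => ?_⟩, by simp, by simp⟩
  rw [Finset.mem_insert, Finset.mem_singleton] at ha hb
  rcases ha with rfl | rfl <;> rcases hb with rfl | rfl
  · simp
  · exact h
  · rwa [dist_comm]
  · simp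

theorem not_adjacent_iff_eq_neg {r : ℝ} (h₁ : 1 / 2 < r) (h₂ : r ≤ 1 / √3)
    (x y : regularHexagon r) (hxy : x ≠ y) :
    ¬ Adjacent (ripsComplex (regularHexagon r)) x y ↔
      (y : EuclideanSpace ℝ (Fin 2)) = -(x : EuclideanSpace ℝ (Fin 2)) := by
  have hr : 0 < r := by linarith
  obtain ⟨⟨i, a⟩, rfl⟩ := (hexagonEquiv hr).surjective x
  obtain ⟨⟨j, b⟩, rfl⟩ := (hexagonEquiv hr).surjective y
  rw [adjacent_ripsComplex_iff, and_iff_right hxy]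
  simp only [coe_hexagonEquiv, dist_signedVertex_le_one_iff h₁ h₂]
  rw [← signedVertex_opposite, (signedVertex_injective hr).eq_iff, Compatible, not_not,
    Prod.mk.injEq, eq_comm (a := i)]
  refine and_congr_right fun _ => ?_
  cases a <;> cases b <;> simp

/-- The Rips complex of the hexagon is homeomorphic to the octahedron. -/
noncomputable def octahedronRipsHomeomorph {r : ℝ} (h₁ : 1 / 2 < r) (h₂ : r ≤ 1 / √3)
    (hr : 0 < r) : realization octahedron ≃ₜ realization (ripsComplex (regularHexagon r)) :=
  realizationHomeomorph (hexagonEquiv hr) (map_hexagonEquiv_mem_ripsComplex h₁ h₂ hr)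

/-! ### The shadow of the hexagon -/

theorem affineMap_octahedronRipsHomeomorph {r : ℝ} (h₁ : 1 / 2 < r) (h₂ : r ≤ 1 / √3)
    (hr : 0 < r) {a : Fin 3 → ℝ} (ha : ∑ i, |a i| = 1) :
    affineMap (ripsComplex (regularHexagon r)) (octahedronRipsHomeomorph h₁ h₂ hr
      ⟨signedWeight a, signedWeight_mem_realization ha⟩) = ∑ i, a i • triangleVertex r i := by
  have e : affineMap (ripsComplex (regularHexagon r)) (octahedronRipsHomeomorph h₁ h₂ hr
      ⟨signedWeight a, signedWeight_mem_realization ha⟩) = ∑ x : regularHexagon r,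
        signedWeight a ((hexagonEquiv hr).symm x) • (x : EuclideanSpace ℝ (Fin 2)) := rfl
  rw [e]
  rw [← Equiv.sum_comp (hexagonEquiv hr)]
  simp only [Equiv.symm_apply_apply, coe_hexagonEquiv]
  rw [sum_prod_bool]
  refine Finset.sum_congr rfl fun i _ => ?_
  rw [← signedWeight_true_sub_false a i, sub_smul]
  simp [signedVertex, sub_eq_add_neg]

/-- Adding a constant to the three coordinates does not change the image in the plane, but allows
to increase the `ℓ¹` norm up to `1`. -/
theorem exists_add_const_sum_abs_eq_one {a : Fin 3 → ℝ} (ha : ∑ i, |a i| ≤ 1) :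
    ∃ s : ℝ, ∑ i, |a i + s| = 1 := by
  have hc : ContinuousOn (fun s : ℝ => ∑ i, |a i + s|) (Set.Icc 0 2) := by fun_prop
  have h0 : |a 0| ≤ ∑ i, |a i| :=
    Finset.single_le_sum (f := fun i => |a i|) (fun i _ => abs_nonneg _) (Finset.mem_univ 0)
  have h2 : |a 0 + 2| ≤ ∑ i, |a i + 2| :=
    Finset.single_le_sum (f := fun i => |a i + 2|) (fun i _ => abs_nonneg _) (Finset.mem_univ 0)
  have h3 := (abs_le.1 (h0.trans ha)).1
  have h4 := le_abs_self (a 0 + 2)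
  obtain ⟨s, -, hs⟩ := intermediate_value_Icc (by norm_num : (0 : ℝ) ≤ 2) hc
    (show (1 : ℝ) ∈ _ from ⟨by simpa using ha, by linarith⟩)
  exact ⟨s, hs⟩

theorem convexHull_regularHexagon_subset (r : ℝ) :
    convexHull ℝ (regularHexagon r : Set (EuclideanSpace ℝ (Fin 2))) ⊆
      {y | ∃ a : Fin 3 → ℝ, ∑ i, |a i| ≤ 1 ∧ ∑ i, a i • triangleVertex r i = y} := by
  refine convexHull_min ?_ ?_
  · intro x hx
    obtain ⟨⟨i, b⟩, rfl⟩ := mem_regularHexagon_iff.1 (Finset.mem_coe.1 hx)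
    cases b
    · refine ⟨Pi.single i (-1), ?_, ?_⟩
      · rw [Finset.sum_eq_single i (fun j _ hj => by simp [hj]) (by simp)]
        simp
      · rw [Finset.sum_eq_single i (fun j _ hj => by simp [hj]) (by simp)]
        simp [signedVertex]
    · refine ⟨Pi.single i 1, ?_, ?_⟩
      · rw [Finset.sum_eq_single i (fun j _ hj => by simp [hj]) (by simp)]
        simp
      · rw [Finset.sum_eq_single i (fun j _ hj => by simp [hj]) (by simp)]
        simp [signedVertex]
  · rintro _ ⟨a, ha, rfl⟩ _ ⟨b, hb, rfl⟩ s t hs ht hst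
    refine ⟨fun i => s * a i + t * b i, ?_, ?_⟩
    · calc ∑ i, |s * a i + t * b i| ≤ ∑ i, (s * |a i| + t * |b i|) :=
            Finset.sum_le_sum fun i _ => (abs_add_le _ _).trans_eq (by
              rw [abs_mul, abs_mul, abs_of_nonneg hs, abs_of_nonneg ht])
        _ = s * ∑ i, |a i| + t * ∑ i, |b i| := by
            rw [Finset.sum_add_distrib, Finset.mul_sum, Finset.mul_sum]
        _ ≤ 1 := by nlinarith
    · simp only [Finset.smul_sum, add_smul, mul_smul, Finset.sum_add_distrib]

theorem shadow_subset_convexHull {n : ℕ} {X : Finset (EuclideanSpace ℝ (Fin n))}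
    (K : AbstractSimplicialComplex X) :
    shadow K ⊆ convexHull ℝ (X : Set (EuclideanSpace ℝ (Fin n))) := by
  rintro _ ⟨w, rfl⟩
  exact (convex_convexHull ℝ _).sum_mem (fun v _ => w.2.1.1 v) w.2.1.2
    fun v _ => subset_convexHull ℝ _ v.2

theorem shadow_regularHexagon {r : ℝ} (h₁ : 1 / 2 < r) (h₂ : r ≤ 1 / √3) :
    shadow (ripsComplex (regularHexagon r)) =
      convexHull ℝ (regularHexagon r : Set (EuclideanSpace ℝ (Fin 2))) := by
  refine (shadow_subset_convexHull _).antisymm fun y hy => ?_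
  obtain ⟨a, ha, rfl⟩ := convexHull_regularHexagon_subset r hy
  obtain ⟨s, hs⟩ := exists_add_const_sum_abs_eq_one ha
  refine ⟨_, (affineMap_octahedronRipsHomeomorph h₁ h₂ (by linarith) hs).trans ?_⟩
  simp only [add_smul, Finset.sum_add_distrib, ← Finset.smul_sum, sum_triangleVertex, smul_zero,
    add_zero]

theorem not_isKConnectedMap_projection {r : ℝ} (h₁ : 1 / 2 < r) (h₂ : r ≤ 1 / √3) :
    ¬ IsKConnectedMap 2 (projection (ripsComplex (regularHexagon r))) :=
  not_isKConnectedMap_of_convex (shadow_regularHexagon h₁ h₂ ▸ convex_convexHull ℝ _)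
    (octahedronRipsHomeomorph h₁ h₂ (by linarith)) _

end RipsShadow

theorem mainTheorem7 :
    (∃ X : Finset (EuclideanSpace ℝ (Fin 2)),
      ¬ RipsShadow.IsKConnectedMap 2 (RipsShadow.projection (RipsShadow.ripsComplex X))) ∧
    ∀ r : ℝ, 1 / 2 < r → r ≤ 1 / Real.sqrt 3 →
      -- the pairs of vertices that are not joined by an edge are exactly the three main diagonals
      (∀ x y : RipsShadow.regularHexagon r, x ≠ y →
        (¬ RipsShadow.Adjacent (RipsShadow.ripsComplex (RipsShadow.regularHexagon r)) x y ↔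
          (y : EuclideanSpace ℝ (Fin 2)) = -(x : EuclideanSpace ℝ (Fin 2)))) ∧
      RipsShadow.SimpliciallyIsomorphic
        (RipsShadow.ripsComplex (RipsShadow.regularHexagon r)) RipsShadow.octahedron ∧
      Nonempty (ContinuousMap.HomotopyEquiv
        (RipsShadow.realization (RipsShadow.ripsComplex (RipsShadow.regularHexagon r)))
        (Metric.sphere (0 : EuclideanSpace ℝ (Fin 3)) 1)) ∧
      RipsShadow.shadow (RipsShadow.ripsComplex (RipsShadow.regularHexagon r)) =
        convexHull ℝ (RipsShadow.regularHexagon r : Set (EuclideanSpace ℝ (Fin 2))) ∧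
      ContractibleSpace
        (RipsShadow.shadow (RipsShadow.ripsComplex (RipsShadow.regularHexagon r))) ∧
      ¬ RipsShadow.IsKConnectedMap 2
        (RipsShadow.projection (RipsShadow.ripsComplex (RipsShadow.regularHexagon r))) := by
  have h3 : (1 / 2 : ℝ) < 1 / √3 :=
    one_div_lt_one_div_of_lt (by positivity) ((Real.sqrt_lt' (by norm_num)).2 (by norm_num))
  refine ⟨⟨_, RipsShadow.not_isKConnectedMap_projection h3 le_rfl⟩, fun r h₁ h₂ => ?_⟩
  have hr : 0 < r := by linarith
  refine ⟨RipsShadow.not_adjacent_iff_eq_neg h₁ h₂,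
    RipsShadow.simpliciallyIsomorphic_octahedron h₁ h₂,
    ⟨((RipsShadow.octahedronRipsHomeomorph h₁ h₂ hr).symm.trans
      (RipsShadow.octahedronHomeomorph.trans RipsShadow.radialHomeomorph)).toHomotopyEquiv⟩,
    RipsShadow.shadow_regularHexagon h₁ h₂, ?_,
    RipsShadow.not_isKConnectedMap_projection h₁ h₂⟩
  rw [RipsShadow.shadow_regularHexagon h₁ h₂]
  exact (convex_convexHull ℝ _).contractibleSpace
    (convexHull_nonempty_iff.2 ⟨_, (RipsShadow.hexagonEquiv hr (0, true)).2⟩)
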